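/- Let $k$ be an algebraically closed field of characteristic $0$; all algebras below are finite dimensional over $k$. A \emph{Lie-Yamaguti algebra} (LY-algebra) is a vector space $\mathfrak m$ with a bilinear product $x\cdot y$ and a trilinear product $[x,y,z]$ such that, for all elements (with $\sum_{(x,y,z)}$ denoting the cyclic sum over $x,y,z$), $x\cdot x=0$; $[x,x,y]=0$; $\sum_{(x,y,z)}\bigl([x,y,z]+(x\cdot y)\cdot z\bigr)=0$; $\sum_{(x,y,z)}[x\cdot y,z,t]=0$; $[x,y,u\cdot v]=[x,y,u]\cdot v+u\cdot[x,y,v]$; and $[x,y,[u,v,w]]=[[x,y,u],v,w]+[u,[x,y,v],w]+[u,v,[x,y,w]]$. Put $D(x,y)=[x,y,-]\in\operatorname{End}_k(\mathfrak m)$ and let $D(\mathfrak m,\mathfrak m)$ be the linear span of the maps $D(x,y)$, a Lie algebra under the commutator. The \emph{standard enveloping Lie algebra} of $\mathfrak m$ is $\mathfrak g(\mathfrak m)=D(\mathfrak m,\mathfrak m)\oplus\mathfrak m$, in which $D(\mathfrak m,\mathfrak m)$ is a subalgebra, $[d,z]=d(z)$ for $d\in D(\mathfrak m,\mathfrak m)$,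 $z\in\mathfrak m$, and $[z,t]=D(z,t)+z\cdot t$ for $z,t\in\mathfrak m$. The LY-algebra $\mathfrak m$ is \emph{irreducible} if it is an irreducible $D(\mathfrak m,\mathfrak m)$-module, and it is of \emph{adjoint type} if, as a $D(\mathfrak m,\mathfrak m)$-module, it is isomorphic to the adjoint module $D(\mathfrak m,\mathfrak m)$. \textbf{Theorem.} Up to isomorphism, the irreducible LY-algebras of adjoint type are exactly the simple Lie algebras $L$ with binary and ternary products of one of the following types: \begin{enumerate} \item[(i)] $x\cdot y=0$ and $[x,y,z]=[[x,y],z]$; \item[(ii)] $x\cdot y=[x,y]$ and $[x,y,z]=\beta[[x,y],z]$, for some $\beta\in k$, $\beta\neq 0$; \end{enumerate} where $[x,y]$ is the Lie bracket of $L$. That is, an LY-algebra is irreducible and of adjoint type if and only if it is isomorphic to one of these. Moreover, the standard enveloping Lie algebra is isomorphic to the direct sum $L\oplus L$ of two copies of $L$ in case (i) and in case (ii) with $\beta\neq-1/4$. In case (ii) with $\beta=-1/4$, it is isomorphic to $k[t]/(t^2)\otimes_k L$. -/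

import Mathlib

open scoped TensorProduct Polynomial

universe u v w

attribute [local instance 100] LieRing.ofAssociativeRing

/-- A Lie-Yamaguti algebra structure on a `k`-vector space `m`: a bilinear product
`mul x y = x · y` and a trilinear product `triple x y z = [x, y, z]` satisfying (LY1)-(LY6). -/
structure LYAlgebra (k m : Type*) [Field k] [AddCommGroup m] [Module k m] where
  mul : m →ₗ[k] m →ₗ[k] m
  triple : m →ₗ[k] m →ₗ[k] m →ₗ[k] m
  mul_self : ∀ x, mul x x = 0
  triple_self : ∀ x y, triple x x y = 0
  cyclic_triple_mul : ∀ x y z,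
    (triple x y z + mul (mul x y) z) + (triple y z x + mul (mul y z) x)
      + (triple z x y + mul (mul z x) y) = 0
  cyclic_mul_triple : ∀ x y z t,
    triple (mul x y) z t + triple (mul y z) x t + triple (mul z x) y t = 0
  triple_mul : ∀ x y u v,
    triple x y (mul u v) = mul (triple x y u) v + mul u (triple x y v)
  triple_triple : ∀ x y u v w,
    triple x y (triple u v w) =
      triple (triple x y u) v w + triple u (triple x y v) w + triple u v (triple x y w)

namespace LYAlgebra

section Basic

variable {k m : Type*} [Field k] [AddCommGroup m] [Module k m] (A : LYAlgebra k m)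

theorem triple_swap (x y z : m) : A.triple x y z = - A.triple y x z := by
  have h := A.triple_self (x + y) z
  simp only [map_add, LinearMap.add_apply, A.triple_self, zero_add, add_zero] at h
  exact eq_neg_of_add_eq_zero_right h

theorem mul_swap (x y : m) : A.mul x y = - A.mul y x := by
  have h := A.mul_self (x + y)
  simp only [map_add, LinearMap.add_apply, A.mul_self, zero_add, add_zero] at h
  exact eq_neg_of_add_eq_zero_right h

theorem lie_triple (x y u v : m) :
    ⁅(A.triple x y : Module.End k m), (A.triple u v : Module.End k m)⁆ =
      A.triple (A.triple x y u) v + A.triple u (A.triple x y v) := by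
  apply LinearMap.ext
  intro w
  change A.triple x y (A.triple u v w) - A.triple u v (A.triple x y w) = _
  rw [A.triple_triple, add_sub_cancel_right]
  rfl

/-- `D(m,m)`: the linear span, inside `End_k(m)`, of the inner derivations
`D(x,y) = [x, y, -]`; it is closed under the commutator. -/
def innerDer : LieSubalgebra k (Module.End k m) where
  toSubmodule := Submodule.span k {d | ∃ x y : m, d = A.triple x y}
  lie_mem' := by
    intro d e hd he
    change d ∈ Submodule.span k {d : Module.End k m | ∃ x y : m, d = A.triple x y} at hd
    change e ∈ Submodule.span k {d : Module.End k m | ∃ x y : m, d = A.triple x y} at he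
    change ⁅d, e⁆ ∈ Submodule.span k {d : Module.End k m | ∃ x y : m, d = A.triple x y}
    induction hd using Submodule.span_induction with
    | mem d hd =>
      obtain ⟨x, y, rfl⟩ := hd
      induction he using Submodule.span_induction with
      | mem e he =>
        obtain ⟨u, v, rfl⟩ := he
        rw [A.lie_triple]
        exact add_mem (Submodule.subset_span ⟨_, _, rfl⟩) (Submodule.subset_span ⟨_, _, rfl⟩)
      | zero => simp
      | add a b _ _ ha hb => rw [lie_add]; exact add_mem ha hb
      | smul c a _ ha => rw [lie_smul]; exact Submodule.smul_mem _ _ ha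
    | zero => simp
    | add a b _ _ ha hb => rw [add_lie]; exact add_mem ha hb
    | smul c a _ ha => rw [smul_lie]; exact Submodule.smul_mem _ _ ha

/-- The inner derivation `D(x,y) : z ↦ [x, y, z]`, as an element of `D(m,m)`. -/
def D (x y : m) : A.innerDer :=
  ⟨A.triple x y, Submodule.subset_span ⟨x, y, rfl⟩⟩

/-- `m` is irreducible as a module for `D(m,m)` (in particular `m` is nonzero). -/
def IsIrreducible : Prop :=
  LieModule.IsIrreducible k A.innerDer m

/-- `m` is of adjoint type: as a `D(m,m)`-module, it is (isomorphic to) the adjoint module. -/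
def IsAdjointType : Prop :=
  Nonempty (A.innerDer ≃ₗ⁅k, A.innerDer⁆ m)

theorem D_apply (x y z : m) : (A.D x y : Module.End k m) z = A.triple x y z := rfl

/-- Elements of `D(m,m)` are derivations of the binary product. -/
theorem innerDer_mul (d : A.innerDer) (u v : m) :
    (d : Module.End k m) (A.mul u v) =
      A.mul ((d : Module.End k m) u) v + A.mul u ((d : Module.End k m) v) := by
  obtain ⟨d, hd⟩ := d
  change d ∈ Submodule.span k {d : Module.End k m | ∃ x y : m, d = A.triple x y} at hd
  change d (A.mul u v) = A.mul (d u) v + A.mul u (d v)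
  induction hd using Submodule.span_induction with
  | mem d hd => obtain ⟨x, y, rfl⟩ := hd; exact A.triple_mul x y u v
  | zero => simp
  | add a b _ _ ha hb => simp only [LinearMap.add_apply, ha, hb, map_add]; abel
  | smul c a _ ha => simp only [LinearMap.smul_apply, ha, map_smul, smul_add]

/-- Elements of `D(m,m)` are derivations of the ternary product. -/
theorem innerDer_triple (d : A.innerDer) (u v w : m) :
    (d : Module.End k m) (A.triple u v w) =
      A.triple ((d : Module.End k m) u) v w + A.triple u ((d : Module.End k m) v) w
        + A.triple u v ((d : Module.End k m) w) := by
  obtain ⟨d, hd⟩ := d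
  change d ∈ Submodule.span k {d : Module.End k m | ∃ x y : m, d = A.triple x y} at hd
  change d (A.triple u v w) = A.triple (d u) v w + A.triple u (d v) w + A.triple u v (d w)
  induction hd using Submodule.span_induction with
  | mem d hd => obtain ⟨x, y, rfl⟩ := hd; exact A.triple_triple x y u v w
  | zero => simp
  | add a b _ _ ha hb => simp only [LinearMap.add_apply, ha, hb, map_add]; abel
  | smul c a _ ha => simp only [LinearMap.smul_apply, ha, map_smul, smul_add]

/-- The underlying vector space `D(m,m) ⊕ m` of the standard enveloping Lie algebra `g(m)`. -/
@[ext]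
structure Envelope where
  der : A.innerDer
  vec : m

namespace Envelope

variable {A}

/-- The bijection of `D(m,m) ⊕ m` with the product `D(m,m) × m`. -/
def toProd (p : A.Envelope) : A.innerDer × m := (p.der, p.vec)

theorem toProd_injective : Function.Injective (toProd : A.Envelope → A.innerDer × m) := by
  intro p q h
  exact Envelope.ext (congrArg Prod.fst h) (congrArg Prod.snd h)

instance : Zero A.Envelope := ⟨⟨0, 0⟩⟩
instance : Add A.Envelope := ⟨fun p q => ⟨p.der + q.der, p.vec + q.vec⟩⟩
instance : Neg A.Envelope := ⟨fun p => ⟨-p.der, -p.vec⟩⟩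
instance : Sub A.Envelope := ⟨fun p q => ⟨p.der - q.der, p.vec - q.vec⟩⟩
instance : SMul ℕ A.Envelope := ⟨fun n p => ⟨n • p.der, n • p.vec⟩⟩
instance : SMul ℤ A.Envelope := ⟨fun n p => ⟨n • p.der, n • p.vec⟩⟩
instance : SMul k A.Envelope := ⟨fun c p => ⟨c • p.der, c • p.vec⟩⟩

instance : AddCommGroup A.Envelope :=
  toProd_injective.addCommGroup toProd rfl (fun _ _ => rfl) (fun _ => rfl) (fun _ _ => rfl)
    (fun _ _ => rfl) (fun _ _ => rfl)

instance : Module k A.Envelope :=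
  toProd_injective.module k
    { toFun := toProd, map_zero' := rfl, map_add' := fun _ _ => rfl } (fun _ _ => rfl)

/-- The bracket of the standard enveloping Lie algebra: the commutator on `D(m,m)`,
`[d, z] = d(z)` for `d ∈ D(m,m)` and `z ∈ m`, and `[z, t] = D(z,t) + z · t` for `z, t ∈ m`. -/
instance : Bracket A.Envelope A.Envelope where
  bracket p q :=
    ⟨⁅p.der, q.der⁆ + A.D p.vec q.vec,
      (p.der : Module.End k m) q.vec - (q.der : Module.End k m) p.vec + A.mul p.vec q.vec⟩

theorem ext' {p q : A.Envelope}
    (h1 : ∀ z : m, (p.der : Module.End k m) z = (q.der : Module.End k m) z)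
    (h2 : p.vec = q.vec) : p = q :=
  Envelope.ext (Subtype.ext (LinearMap.ext h1)) h2

theorem lie_der (p q : A.Envelope) : (⁅p, q⁆ : A.Envelope).der =
    ⁅p.der, q.der⁆ + A.D p.vec q.vec := rfl

theorem lie_der_apply (p q : A.Envelope) (z : m) :
    ((⁅p, q⁆ : A.Envelope).der : Module.End k m) z =
      (p.der : Module.End k m) ((q.der : Module.End k m) z)
        - (q.der : Module.End k m) ((p.der : Module.End k m) z) + A.triple p.vec q.vec z := rfl

theorem lie_vec (p q : A.Envelope) : (⁅p, q⁆ : A.Envelope).vec =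
    (p.der : Module.End k m) q.vec - (q.der : Module.End k m) p.vec
      + A.mul p.vec q.vec := rfl

theorem add_der_apply (p q : A.Envelope) (z : m) : ((p + q).der : Module.End k m) z =
    (p.der : Module.End k m) z + (q.der : Module.End k m) z := rfl

theorem add_vec (p q : A.Envelope) : (p + q).vec = p.vec + q.vec := rfl

theorem smul_der_apply (c : k) (p : A.Envelope) (z : m) :
    ((c • p).der : Module.End k m) z = c • (p.der : Module.End k m) z := rfl

theorem smul_vec (c : k) (p : A.Envelope) : (c • p).vec = c • p.vec := rfl

instance : LieRing A.Envelope where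
  add_lie p q r := by
    apply ext'
    · intro z
      simp only [lie_der_apply, add_der_apply, add_vec, map_add, LinearMap.add_apply]; abel
    · simp only [lie_vec, add_der_apply, add_vec, map_add, LinearMap.add_apply]; abel
  lie_add p q r := by
    apply ext'
    · intro z
      simp only [lie_der_apply, add_der_apply, add_vec, map_add, LinearMap.add_apply]; abel
    · simp only [lie_vec, add_der_apply, add_vec, map_add]; abel
  lie_self p := by
    apply ext'
    · intro z
      rw [lie_der_apply, A.triple_self, sub_self, add_zero]; rfl
    · rw [lie_vec, A.mul_self, sub_self, add_zero]; rfl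
  leibniz_lie p q r := by
    apply ext'
    · intro w
      have h := A.cyclic_mul_triple p.vec q.vec r.vec w
      rw [A.triple_swap (A.mul q.vec r.vec) p.vec, A.mul_swap r.vec p.vec, map_neg,
        LinearMap.neg_apply, LinearMap.neg_apply,
        A.triple_swap (A.mul p.vec r.vec) q.vec] at h
      have h' : A.triple p.vec (A.mul q.vec r.vec) w
          = A.triple (A.mul p.vec q.vec) r.vec w + A.triple q.vec (A.mul p.vec r.vec) w := by
        rw [← sub_eq_zero, ← neg_eq_zero, ← h]; abel
      simp only [lie_der_apply, lie_vec, add_der_apply, map_add, map_sub, LinearMap.add_apply,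
        LinearMap.sub_apply, A.innerDer_triple, h']
      rw [A.triple_swap ((q.der : Module.End k m) p.vec) r.vec w,
        A.triple_swap q.vec ((r.der : Module.End k m) p.vec) w,
        A.triple_swap r.vec ((q.der : Module.End k m) p.vec) w]
      abel
    · have h := A.cyclic_triple_mul p.vec q.vec r.vec
      rw [A.mul_swap (A.mul q.vec r.vec) p.vec, A.mul_swap r.vec p.vec, map_neg,
        LinearMap.neg_apply, A.mul_swap (A.mul p.vec r.vec) q.vec,
        A.triple_swap r.vec p.vec] at h
      have h' : A.mul p.vec (A.mul q.vec r.vec)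
          = A.triple p.vec q.vec r.vec + A.triple q.vec r.vec p.vec
            - A.triple p.vec r.vec q.vec
            + A.mul (A.mul p.vec q.vec) r.vec + A.mul q.vec (A.mul p.vec r.vec) := by
        rw [← sub_eq_zero, ← neg_eq_zero, ← h]; abel
      simp only [lie_vec, lie_der_apply, add_vec, map_add, map_sub, LinearMap.add_apply,
        LinearMap.sub_apply, A.innerDer_mul, h']
      rw [A.mul_swap q.vec ((r.der : Module.End k m) p.vec)]
      abel

/-- The standard enveloping Lie algebra `g(m) = D(m,m) ⊕ m`. -/
instance : LieAlgebra k A.Envelope where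
  lie_smul c p q := by
    apply ext'
    · intro z
      simp only [lie_der_apply, smul_der_apply, smul_vec, map_smul, LinearMap.smul_apply,
        smul_add, smul_sub]
    · simp only [lie_vec, smul_der_apply, smul_vec, map_smul, smul_add, smul_sub]

end Envelope

/-- `A` and `B` are isomorphic Lie-Yamaguti algebras: some linear bijection preserves both the
binary and the ternary products. -/
def Isomorphic {n : Type*} [AddCommGroup n] [Module k n] (B : LYAlgebra k n) : Prop :=
  ∃ f : m ≃ₗ[k] n,
    (∀ x y, f (A.mul x y) = B.mul (f x) (f y)) ∧
    (∀ x y z, f (A.triple x y z) = B.triple (f x) (f y) (f z))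

end Basic

section OfLie

variable (k L : Type*) [Field k] [LieRing L] [LieAlgebra k L]

/-- For a Lie algebra `L` and scalars `α, β`, the Lie-Yamaguti algebra on `L` with
`x · y = α [x,y]` and `[x,y,z] = β [[x,y],z]`. -/
def ofLie (α β : k) : LYAlgebra k L where
  mul := LinearMap.mk₂ k (fun x y => α • ⁅x, y⁆)
    (fun _ _ _ => by rw [add_lie, smul_add])
    (fun c _ _ => by rw [smul_lie, smul_comm])
    (fun _ _ _ => by rw [lie_add, smul_add])
    (fun c _ _ => by rw [lie_smul, smul_comm])
  triple := LinearMap.mk₂ k (fun x y => β • (LieModule.toEnd k L L ⁅x, y⁆ : L →ₗ[k] L))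
    (fun _ _ _ => by rw [add_lie, map_add, smul_add])
    (fun c _ _ => by rw [smul_lie, map_smul, smul_comm])
    (fun _ _ _ => by rw [lie_add, map_add, smul_add])
    (fun c _ _ => by rw [lie_smul, map_smul, smul_comm])
  mul_self x := by simp
  triple_self x y := by simp
  cyclic_triple_mul x y z := by
    have h := lie_jacobi x y z
    have h' : ⁅⁅x, y⁆, z⁆ + ⁅⁅y, z⁆, x⁆ + ⁅⁅z, x⁆, y⁆ = 0 := by
      rw [← lie_skew, ← lie_skew ⁅y, z⁆ x, ← lie_skew ⁅z, x⁆ y, ← neg_eq_zero, ← h]; abel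
    have e : (β + α * α) • (⁅⁅x, y⁆, z⁆ + ⁅⁅y, z⁆, x⁆ + ⁅⁅z, x⁆, y⁆) = 0 := by
      rw [h', smul_zero]
    rw [← e]
    simp only [LinearMap.mk₂_apply, LinearMap.smul_apply, LieModule.toEnd_apply_apply, smul_lie]
    module
  cyclic_mul_triple x y z t := by
    have h := lie_jacobi x y z
    have h' : ⁅⁅x, y⁆, z⁆ + ⁅⁅y, z⁆, x⁆ + ⁅⁅z, x⁆, y⁆ = 0 := by
      rw [← lie_skew, ← lie_skew ⁅y, z⁆ x, ← lie_skew ⁅z, x⁆ y, ← neg_eq_zero, ← h]; abel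
    have e : (β * α) • ⁅⁅⁅x, y⁆, z⁆ + ⁅⁅y, z⁆, x⁆ + ⁅⁅z, x⁆, y⁆, t⁆ = 0 := by
      rw [h', zero_lie, smul_zero]
    rw [← e]
    simp only [LinearMap.mk₂_apply, LinearMap.smul_apply, LieModule.toEnd_apply_apply, smul_lie,
      add_lie]
    module
  triple_mul x y u v := by
    simp only [LinearMap.mk₂_apply, LinearMap.smul_apply, LieModule.toEnd_apply_apply, smul_lie,
      lie_smul, leibniz_lie ⁅x, y⁆ u v]
    module
  triple_triple x y u v w := by
    simp only [LinearMap.mk₂_apply, LinearMap.smul_apply, LieModule.toEnd_apply_apply, smul_lie,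
      lie_smul, leibniz_lie ⁅x, y⁆ ⁅u, v⁆ w, leibniz_lie ⁅x, y⁆ u v, add_lie]
    module

theorem ofLie_mul (α β : k) (x y : L) : (ofLie k L α β).mul x y = α • ⁅x, y⁆ := rfl

theorem ofLie_triple (α β : k) (x y z : L) :
    (ofLie k L α β).triple x y z = β • ⁅⁅x, y⁆, z⁆ := rfl

end OfLie

end LYAlgebra

/-! ### Root spaces and equivariant alternating products. -/

namespace LieAlgebra.IsKilling

open LieAlgebra LieModule

variable {K L : Type*} [Field K] [IsAlgClosed K] [CharZero K] [LieRing L] [LieAlgebra K L]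
  [FiniteDimensional K L] [IsKilling K L] {H : LieSubalgebra K L} [H.IsCartanSubalgebra]

/-! For `m` irreducible of adjoint type, transport everything to `L = D(m,m)`. Submodules of the
adjoint module are ideals, so `L` is simple, and both `x · y` and `D(x,y)` become alternating
`L`-equivariant bilinear maps `L × L → L`. The decisive fact (`exists_eq_smul_lie`) is that such a
map is a multiple of the bracket, whence `x · y = α[x,y]` and `[x,y,z] = β[[x,y],z]`. Here `β ≠ 0`
because the `D(x,y)` span `L ≠ 0`. Rescaling the identification by `c` divides `α` by `c` and `β` by
`c²`, which leaves the two listed families.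

The decisive fact is proved with root spaces: the map vanishes on `H × H`, then acts on a root
vector `e` by a multiple of the root. Subtracting that multiple of the bracket gives a map killing
`e`, and simplicity propagates the vanishing to all of `L`.

Conversely, `β ≠ 0` and `[L,L] = L` make `D(m,m)` a copy of `ad L`. The envelope is then `L ⊗
k[t]/(t² - αt - β)`: two copies of `L` for distinct roots, dual numbers for a double root, that is,
when `α² + 4β = 0`. -/

theorem mem_rootSpace_iff {χ : H → K} {x : L} :
    x ∈ rootSpace H χ ↔ ∀ h : H, ⁅(h : L), x⁆ = χ h • x := by
  refine ⟨fun hx h => lie_eq_smul_of_mem_rootSpace hx h, fun hx => ?_⟩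
  refine (mem_genWeightSpace L χ x).mpr fun h => ⟨1, ?_⟩
  have := hx h
  simpa [sub_eq_zero] using this

theorem mem_rootSpace_zero_iff {K L : Type*} [Field K] [LieRing L] [LieAlgebra K L]
    [FiniteDimensional K L] {H : LieSubalgebra K L} [H.IsCartanSubalgebra] {x : L} :
    x ∈ rootSpace H (0 : H → K) ↔ x ∈ H := by
  rw [rootSpace_zero_eq, LieSubalgebra.mem_toLieSubmodule]

theorem exists_eq_smul_of_mem_rootSpace {α : Weight K H L} (hα : α.IsNonZero) {e x : L}
    (he : e ∈ rootSpace H α) (he0 : e ≠ 0) (hx : x ∈ rootSpace H α) : ∃ c : K, x = c • e := by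
  obtain ⟨c, hc⟩ := (finrank_eq_one_iff_of_nonzero' (⟨e, he⟩ : rootSpace H α)
    (by simpa using he0)).mp (finrank_rootSpace_eq_one α hα) ⟨x, hx⟩
  exact ⟨c, (congrArg Subtype.val hc).symm⟩

theorem span_coroot_eq_top :
    Submodule.span K {h : H | ∃ α : Weight K H L, α.IsNonZero ∧ h = coroot α} = ⊤ := by
  rw [← RootPairing.IsRootSystem.span_coroot_eq_top (P := rootSystem H)]
  congr 1
  ext h
  constructor
  · rintro ⟨α, hα, rfl⟩
    exact ⟨⟨α, by simpa using hα⟩, rfl⟩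
  · rintro ⟨⟨α, hα⟩, rfl⟩
    exact ⟨α, by simpa using hα, rfl⟩

section Bilinear

variable {f : L →ₗ[K] L →ₗ[K] L}

theorem bilin_mem_rootSpace
    (hlie : ∀ x y z : L, ⁅x, f y z⁆ = f ⁅x, y⁆ z + f y ⁅x, z⁆)
    {χ ψ : H → K} {x y : L} (hx : x ∈ rootSpace H χ)
    (hy : y ∈ rootSpace H ψ) : f x y ∈ rootSpace H (χ + ψ) := by
  rw [mem_rootSpace_iff] at *
  intro h
  rw [hlie, hx, hy, map_smul, map_smul, LinearMap.smul_apply, Pi.add_apply, add_smul]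

/-- Correct `t` by a multiple of the coroot, which alternation makes harmless, to get `s` with `α s
= 0`. Then `f s` scales the root line, and bracketing with the opposite root vector, which commutes
with `s`, carries the same scalar to the coroot. -/
theorem exists_bilin_coroot_eq_smul (hf : ∀ x, f x x = 0)
    (hlie : ∀ x y z : L, ⁅x, f y z⁆ = f ⁅x, y⁆ z + f y ⁅x, z⁆)
    {α : Weight K H L} (hα : α.IsNonZero) (t : H) :
    ∃ c : K, f t (coroot α : H) = c • ((coroot α : H) : L) ∧
      (α t = 0 → ∀ e ∈ rootSpace H α, f t e = c • e) := by
  obtain ⟨h, e, f', ht, he, hf'⟩ := exists_isSl2Triple_of_weight_isNonZero hα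
  have hh := ht.h_eq_coroot hα he hf'
  set s : H := t - (α t / 2) • coroot α with hs
  have hts : f t (coroot α : H) = f s (coroot α : H) := by
    simp [hs, hf]
  have hαs : α s = 0 := by
    rw [hs, ← Weight.toLinear_apply, map_sub, map_smul]
    simp [root_apply_coroot hα]
  have hse : f s e ∈ rootSpace H α := by
    have := bilin_mem_rootSpace hlie (mem_rootSpace_zero_iff.mpr s.2) he
    rwa [zero_add] at this
  obtain ⟨c, hc⟩ := exists_eq_smul_of_mem_rootSpace hα he ht.e_ne_zero hse
  refine ⟨c, ?_, fun hαt x hx => ?_⟩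
  · have h1 := hlie f' s e
    rw [← lie_skew f' (s : L), (mem_rootSpace_iff.mp hf') s, hc, lie_smul, ← lie_skew f' e,
      ht.lie_e_f] at h1
    simp only [Pi.neg_apply, hαs] at h1
    rw [hts, ← hh]
    simpa using h1.symm
  · obtain ⟨a, rfl⟩ := exists_eq_smul_of_mem_rootSpace hα he ht.e_ne_zero hx
    have : s = t := by rw [hs, hαt]; simp
    rw [map_smul, ← this, hc, smul_comm]

/-- Coroots span `H`, so it suffices to treat a pair of them. Up to sign, the value is a multiple of
each; if nonzero, it makes the two coroots proportional, and alternation forces zero. -/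
theorem bilin_cartan_eq_zero (hf : ∀ x, f x x = 0)
    (hlie : ∀ x y z : L, ⁅x, f y z⁆ = f ⁅x, y⁆ z + f y ⁅x, z⁆)
    (s t : H) : f s t = 0 := by
  have hswap : ∀ x y, f x y = - f y x := fun x y => by
    have := hf (x + y)
    simp only [map_add, LinearMap.add_apply, hf, zero_add, add_zero] at this
    exact eq_neg_of_add_eq_zero_right this
  have key : ∀ s ∈ (⊤ : Submodule K H), ∀ t ∈ (⊤ : Submodule K H), f (s : H) (t : H) = 0 := by
    rw [← span_coroot_eq_top]
    intro s hs t ht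
    induction hs, ht using Submodule.span_induction₂ with
    | mem_mem x y hx hy =>
      obtain ⟨α, hα, rfl⟩ := hx
      obtain ⟨β, hβ, rfl⟩ := hy
      obtain ⟨a, ha, -⟩ := exists_bilin_coroot_eq_smul hf hlie hα (coroot β)
      obtain ⟨b, hb, -⟩ := exists_bilin_coroot_eq_smul hf hlie hβ (coroot α)
      rcases eq_or_ne b 0 with rfl | hb0
      · simpa using hb
      · have h1 : (coroot β : L) = (b⁻¹ * -a) • (coroot α : L) := by
          rw [hswap, ha] at hb
          rw [mul_smul, neg_smul, hb, inv_smul_smul₀ hb0]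
        rw [h1, map_smul, hf, smul_zero]
    | zero_left => simp
    | zero_right => simp
    | add_left x y z _ _ _ h1 h2 => simp [h1, h2]
    | add_right x y z _ _ _ h1 h2 => simp [h1, h2]
    | smul_left r x y _ _ h => simp [h]
    | smul_right r x y _ _ h => simp [h]
  exact key s trivial t trivial

/-- Elements of `ker α` scale the root line and the coroot by the same scalar, which is zero since
`f` vanishes on `H × H`. Hence the action of `t` depends only on `α t`. -/
theorem exists_bilin_rootSpace_eq_smul (hf : ∀ x, f x x = 0)
    (hlie : ∀ x y z : L, ⁅x, f y z⁆ = f ⁅x, y⁆ z + f y ⁅x, z⁆)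
    (χ : H → K) (x : L) (hx : x ∈ rootSpace H χ) :
    ∃ c : K, ∀ t : H, f t x = (c * χ t) • x := by
  rcases eq_or_ne x 0 with rfl | hx0
  · simp
  have hχ : rootSpace H χ ≠ ⊥ := fun h => hx0 (by simpa [h] using hx)
  obtain ⟨α, rfl⟩ : ∃ α : Weight K H L, χ = α := ⟨⟨χ, hχ⟩, rfl⟩
  by_cases hα : α.IsZero
  · rw [hα.eq, mem_rootSpace_zero_iff] at hx
    refine ⟨0, fun t => ?_⟩
    rw [bilin_cartan_eq_zero hf hlie t ⟨x, hx⟩, zero_mul, zero_smul]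
  have hcor : ((coroot α : H) : L) ≠ 0 := by simpa using hα
  have hker : ∀ s : H, α s = 0 → f s x = 0 := by
    intro s hs
    obtain ⟨c, hc, hc'⟩ := exists_bilin_coroot_eq_smul hf hlie hα s
    rw [bilin_cartan_eq_zero hf hlie] at hc
    have hc0 : c = 0 := (smul_eq_zero.mp hc.symm).resolve_right hcor
    rw [hc' hs x hx, hc0, zero_smul]
  have hmem : f (coroot α : H) x ∈ rootSpace H α := by
    have := bilin_mem_rootSpace hlie (mem_rootSpace_zero_iff.mpr (coroot α).2) hx
    rwa [zero_add] at this
  obtain ⟨c, hc⟩ := exists_eq_smul_of_mem_rootSpace hα hx hx0 hmem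
  -- The factor `1/2` compensates for `α (coroot α) = 2`.
  refine ⟨c / 2, fun t => ?_⟩
  have := hker (t - (α t / 2) • coroot α) (by
    rw [← Weight.toLinear_apply, map_sub, map_smul]
    simp [root_apply_coroot hα])
  simp only [AddSubgroupClass.coe_sub, SetLike.val_smul, map_sub, map_smul,
    LinearMap.sub_apply, LinearMap.smul_apply, hc, sub_eq_zero] at this
  rw [this, smul_smul]
  congr 1
  ring

/-- For `y` of root `β`, bracketing `f t e = 0` with `y` gives `β(t) f(y,e) = c (β + α)(t) [y,e]`.
The right side vanishes in each case: `α = -β` kills the factor, `α = β` kills the bracket, and for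
independent roots some `t` has `β t = 0` and `α t ≠ 0`. -/
theorem bilin_eq_zero_of_rootSpace (hf : ∀ x, f x x = 0)
    (hlie : ∀ x y z : L, ⁅x, f y z⁆ = f ⁅x, y⁆ z + f y ⁅x, z⁆)
    {α : Weight K H L} (hα : α.IsNonZero) {e : L}
    (he : e ∈ rootSpace H α) (he0 : e ≠ 0) (hH : ∀ t : H, f t e = 0) (y : L) : f y e = 0 := by
  have hy : y ∈ ⨆ χ : H → K, rootSpace H χ := by simp [iSup_genWeightSpace_eq_top K H L]
  induction hy using LieSubmodule.iSup_induction' with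
  | zero => simp
  | add x y _ _ hx hy => simp [hx, hy]
  | mem χ y hy =>
    rcases eq_or_ne y 0 with rfl | hy0
    · simp
    have hχ : rootSpace H χ ≠ ⊥ := fun h => hy0 (by simpa [h] using hy)
    obtain ⟨β, rfl⟩ : ∃ β : Weight K H L, χ = β := ⟨⟨χ, hχ⟩, rfl⟩
    by_cases hβ : β.IsZero
    · rw [hβ.eq, mem_rootSpace_zero_iff] at hy
      exact hH ⟨y, hy⟩
    obtain ⟨c, hc⟩ := exists_bilin_rootSpace_eq_smul hf hlie ((β : H → K) + (α : H → K)) ⁅y, e⁆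
      (lie_mem_genWeightSpace_of_mem_genWeightSpace hy he)
    have key : ∀ t : H, β t • f y e = (c * (β t + α t)) • ⁅y, e⁆ := by
      intro t
      have h1 := hlie y t e
      rw [hH, lie_zero, ← lie_skew y (t : L), mem_rootSpace_iff.mp hy t, hc] at h1
      simp only [map_neg, map_smul, LinearMap.neg_apply, LinearMap.smul_apply, Pi.add_apply] at h1
      exact (neg_add_eq_zero.mp h1.symm)
    have hβt : β (coroot β) ≠ 0 := by rw [root_apply_coroot hβ]; exact two_ne_zero
    suffices ∀ t, (c * (β t + α t)) • ⁅y, e⁆ = 0 by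
      have := (key (coroot β)).trans (this _)
      exact (smul_eq_zero.mp this).resolve_left hβt
    by_cases hprop : ∃ r : K, (α : H → K) = r • (β : H → K)
    · obtain ⟨r, hr⟩ := hprop
      rcases eq_neg_or_eq_of_eq_smul β α hα r hr with h | h
      · subst h
        simp
      · subst h
        obtain ⟨a, rfl⟩ := exists_eq_smul_of_mem_rootSpace hα he he0 hy
        simp
    · obtain ⟨t, ht, ht'⟩ : ∃ t : H, β t = 0 ∧ α t ≠ 0 := by
        by_contra! hcon
        refine hprop ⟨α (coroot β) / 2, funext fun t => ?_⟩
        have := hcon (t - (β t / 2) • coroot β) (by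
          rw [← Weight.toLinear_apply, map_sub, map_smul]
          simp [root_apply_coroot hβ])
        rw [← Weight.toLinear_apply, map_sub, map_smul, sub_eq_zero] at this
        simp only [Weight.toLinear_apply, smul_eq_mul] at this
        rw [this, Pi.smul_apply, smul_eq_mul]
        ring
      have := key t
      rw [ht, zero_smul, zero_add, mul_smul, smul_comm] at this
      have h2 := (smul_eq_zero.mp this.symm).resolve_left ht'
      intro s
      rw [mul_comm, mul_smul, h2, smul_zero]

end Bilinear

end LieAlgebra.IsKilling

/-! ### Uniqueness of the bracket on a simple Lie algebra. -/

namespace LieAlgebra.IsSimple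

open LieAlgebra LieModule IsKilling

variable {K L : Type*} [Field K] [IsAlgClosed K] [CharZero K] [LieRing L] [LieAlgebra K L]
  [FiniteDimensional K L] [IsSimple K L]

/-- On a simple Lie algebra over an algebraically closed field of characteristic zero, the
equivariant alternating bilinear products are the multiples of the bracket. -/
theorem exists_eq_smul_lie {f : L →ₗ[K] L →ₗ[K] L} (hf : ∀ x, f x x = 0)
    (hlie : ∀ x y z : L, ⁅x, f y z⁆ = f ⁅x, y⁆ z + f y ⁅x, z⁆) :
    ∃ c : K, ∀ x y, f x y = c • ⁅x, y⁆ := by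
  obtain ⟨H, _⟩ : ∃ H : LieSubalgebra K L, H.IsCartanSubalgebra :=
    (LieAlgebra.exists_isCartanSubalgebra_engel K L).elim fun _ h => ⟨_, h⟩
  -- Without roots, `L` would equal its Cartan subalgebra, which is abelian.
  obtain ⟨α, hα⟩ : ∃ α : Weight K H L, α.IsNonZero := by
    by_contra! hcon
    have hH : (⊤ : LieSubmodule K H L) ≤ H.toLieSubmodule := by
      rw [← iSup_genWeightSpace_eq_top' K H L, ← rootSpace_zero_eq]
      refine iSup_le fun α => ?_
      rw [(hcon α).eq]
    refine IsSimple.non_abelian K (L := L) ⟨fun x y => ?_⟩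
    have := trivial_lie_zero H H ⟨x, hH trivial⟩ ⟨y, hH trivial⟩
    exact congrArg Subtype.val this
  obtain ⟨e, he, he0⟩ := α.exists_ne_zero
  obtain ⟨c, hc⟩ := exists_bilin_rootSpace_eq_smul hf hlie α e he
  let g : L →ₗ[K] L →ₗ[K] L := f - c • (LieModule.toEnd K L L : L →ₗ[K] Module.End K L)
  have hg : ∀ x y, g x y = f x y - c • ⁅x, y⁆ := fun x y => rfl
  have hgf : ∀ x, g x x = 0 := by simp [hg, hf]
  have hglie : ∀ x y z : L, ⁅x, g y z⁆ = g ⁅x, y⁆ z + g y ⁅x, z⁆ := by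
    intro x y z
    rw [hg, hg, hg, lie_sub, hlie, lie_smul, leibniz_lie x y z, smul_add]
    abel
  have hge : ∀ t : H, g t e = 0 := by
    intro t
    rw [hg, hc, mem_rootSpace_iff.mp he t, smul_smul, sub_self]
  have hzero := bilin_eq_zero_of_rootSpace hgf hglie hα he he0 hge
  -- By equivariance the right kernel of `g` is an ideal; it contains `e ≠ 0`, hence is everything.
  let I : LieIdeal K L :=
    { LinearMap.ker g.flip with
      lie_mem := by
        intro x z hz
        change g.flip z = 0 at hz
        change g.flip ⁅x, z⁆ = 0
        ext y
        have h1 := hglie x y z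
        rw [show ∀ w, g w z = 0 from fun w => LinearMap.congr_fun hz w,
          show ∀ w, g w z = 0 from fun w => LinearMap.congr_fun hz w, lie_zero, zero_add] at h1
        exact h1.symm }
  have heI : e ∈ I := by
    change g.flip e = 0
    ext y
    exact hzero y
  have hI : I = ⊤ := (IsSimple.eq_bot_or_eq_top I).resolve_left fun h => he0 (by simpa [h] using heI)
  refine ⟨c, fun x y => ?_⟩
  have hy : y ∈ I := hI ▸ trivial
  have := LinearMap.congr_fun (show g.flip y = 0 from hy) x
  rw [LinearMap.flip_apply, hg, LinearMap.zero_apply, sub_eq_zero] at this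
  exact this

end LieAlgebra.IsSimple

/-! ### Perfectness and trivial centre of a simple Lie algebra. -/

namespace LieAlgebra.IsSimple

variable (k L : Type*) [Field k] [LieRing L] [LieAlgebra k L] [IsSimple k L]

theorem span_lie_eq_top : Submodule.span k {z : L | ∃ x y : L, z = ⁅x, y⁆} = ⊤ := by
  have hD : ⁅(⊤ : LieIdeal k L), (⊤ : LieIdeal k L)⁆ = ⊤ := by
    refine (IsSimple.eq_bot_or_eq_top _).resolve_left fun h => ?_
    refine IsSimple.non_abelian k (L := L) ⟨fun x y => ?_⟩
    have : ⁅x, y⁆ ∈ ⁅(⊤ : LieIdeal k L), (⊤ : LieIdeal k L)⁆ :=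
      LieSubmodule.lie_mem_lie trivial trivial
    simpa [h] using this
  rw [eq_top_iff, ← LieSubmodule.top_toSubmodule (R := k) (L := L) (M := L), ← hD,
    LieSubmodule.lieIdeal_oper_eq_linear_span']
  refine Submodule.span_mono ?_
  rintro z ⟨x, -, y, -, rfl⟩
  exact ⟨x, y, rfl⟩

theorem eq_zero_of_forall_lie_eq_zero (k : Type*) {L : Type*} [Field k] [LieRing L]
    [LieAlgebra k L] [IsSimple k L] {x : L} (hx : ∀ y : L, ⁅x, y⁆ = 0) : x = 0 := by
  have h : x ∈ LieAlgebra.center k L := by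
    rw [LieModule.mem_maxTrivSubmodule]
    intro y
    rw [← lie_skew, hx, neg_zero]
  simpa [LieAlgebra.center_eq_bot] using h

end LieAlgebra.IsSimple

/-! ### Products proportional to the bracket: inner derivations and envelopes. -/

namespace LYAlgebra

section OfLieType

variable {k L m : Type*} [Field k] [LieRing L] [LieAlgebra k L] [AddCommGroup m] [Module k m]
  {A : LYAlgebra k m} {f : m ≃ₗ[k] L} {α β : k}

theorem innerDer_toSubmodule_eq_range [LieAlgebra.IsSimple k L] (hβ : β ≠ 0)
    (htriple : ∀ x y z, f (A.triple x y z) = β • ⁅⁅f x, f y⁆, f z⁆) :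
    A.innerDer.toSubmodule =
      LinearMap.range (f.symm.conj.toLinearMap ∘ₗ
        (LieModule.toEnd k L L : L →ₗ[k] Module.End k L)) := by
  have hc : ∀ x y, A.triple x y = β • f.symm.conj (LieModule.toEnd k L L ⁅f x, f y⁆) := by
    intro x y
    ext z
    apply f.injective
    rw [htriple]
    simp [LinearEquiv.conj_apply]
  apply le_antisymm
  · refine Submodule.span_le.mpr ?_
    rintro d ⟨x, y, rfl⟩
    exact ⟨β • ⁅f x, f y⁆, by rw [map_smul, hc]; rfl⟩
  · rw [LinearMap.range_eq_map, ← LieAlgebra.IsSimple.span_lie_eq_top k L, Submodule.map_span,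
      Submodule.span_le]
    rintro d ⟨-, ⟨x, y, rfl⟩, rfl⟩
    -- The factor `β⁻¹` cancels the `β` of the triple product, leaving exactly `ad ⁅x, y⁆`.
    refine Submodule.subset_span ⟨β⁻¹ • f.symm x, f.symm y, ?_⟩
    rw [map_smul, LinearMap.smul_apply, hc, inv_smul_smul₀ hβ]
    simp

theorem exists_lieEquiv_innerDer [LieAlgebra.IsSimple k L] (hβ : β ≠ 0)
    (htriple : ∀ x y z, f (A.triple x y z) = β • ⁅⁅f x, f y⁆, f z⁆) :
    ∃ ψ : L ≃ₗ⁅k⁆ A.innerDer, ∀ a z, f ((ψ a : Module.End k m) z) = ⁅a, f z⁆ := by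
  set c : L →ₗ[k] Module.End k m := f.symm.conj.toLinearMap ∘ₗ
    (LieModule.toEnd k L L : L →ₗ[k] Module.End k L) with hcdef
  have hc : ∀ a z, f (c a z) = ⁅a, f z⁆ := by
    intro a z
    simp [hcdef, LinearEquiv.conj_apply]
  have hinj : Function.Injective c := by
    rw [← LinearMap.ker_eq_bot, LinearMap.ker_eq_bot']
    intro a ha
    refine LieAlgebra.IsSimple.eq_zero_of_forall_lie_eq_zero k fun y => ?_
    have := hc a (f.symm y)
    rwa [ha, LinearMap.zero_apply, map_zero, f.apply_symm_apply, eq_comm] at this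
  let e : L ≃ₗ[k] A.innerDer := (LinearEquiv.ofInjective c hinj).trans
    (LinearEquiv.ofEq _ _ (innerDer_toSubmodule_eq_range hβ htriple).symm)
  have he : ∀ a, (e a : Module.End k m) = c a := fun a => rfl
  refine ⟨{ e with map_lie' := ?_ }, fun a z => hc a z⟩
  intro a b
  apply Subtype.ext
  change c ⁅a, b⁆ = ⁅c a, c b⁆
  ext z
  apply f.injective
  change _ = f (c a (c b z) - c b (c a z))
  rw [map_sub, hc, hc, hc, hc, hc, lie_lie]

theorem isIrreducible_of_triple_eq [LieAlgebra.IsSimple k L] (hβ : β ≠ 0)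
    (htriple : ∀ x y z, f (A.triple x y z) = β • ⁅⁅f x, f y⁆, f z⁆) : A.IsIrreducible := by
  obtain ⟨ψ, hψ⟩ := exists_lieEquiv_innerDer hβ htriple
  have := LieAlgebra.IsSimple.nontrivial k L
  have : Nontrivial m := f.toEquiv.nontrivial
  refine LieModule.IsIrreducible.mk fun N hN => ?_
  let I : LieIdeal k L :=
    { N.toSubmodule.comap f.symm.toLinearMap with
      lie_mem := by
        intro x y hy
        change f.symm y ∈ N at hy
        change f.symm ⁅x, y⁆ ∈ N
        have : f.symm ⁅x, y⁆ = ⁅ψ x, f.symm y⁆ := by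
          rw [LinearEquiv.symm_apply_eq]
          change _ = f ((ψ x : Module.End k m) (f.symm y))
          rw [hψ, f.apply_symm_apply]
        rw [this]
        exact N.lie_mem hy }
  have hI : ∀ y, y ∈ I ↔ f.symm y ∈ N := fun y => Iff.rfl
  rcases LieAlgebra.IsSimple.eq_bot_or_eq_top I with h | h
  · refine (hN ((LieSubmodule.eq_bot_iff N).mpr fun z hz => ?_)).elim
    have : f z ∈ I := by rw [hI, f.symm_apply_apply]; exact hz
    rw [h, LieSubmodule.mem_bot] at this
    simpa using this
  · refine eq_top_iff.mpr fun z _ => ?_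
    have : f z ∈ I := h ▸ trivial
    rwa [hI, f.symm_apply_apply] at this

theorem isAdjointType_of_triple_eq [LieAlgebra.IsSimple k L] (hβ : β ≠ 0)
    (htriple : ∀ x y z, f (A.triple x y z) = β • ⁅⁅f x, f y⁆, f z⁆) : A.IsAdjointType := by
  obtain ⟨ψ, hψ⟩ := exists_lieEquiv_innerDer hβ htriple
  refine ⟨{ ψ.symm.toLinearEquiv.trans f.symm with map_lie' := ?_ }⟩
  intro d e
  change f.symm (ψ.symm ⁅d, e⁆) = (d : Module.End k m) (f.symm (ψ.symm e))
  obtain ⟨a, rfl⟩ := ψ.surjective d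
  obtain ⟨b, rfl⟩ := ψ.surjective e
  change f.symm (ψ.symm ⁅ψ a, ψ b⁆) = (ψ a : Module.End k m) (f.symm (ψ.symm (ψ b)))
  rw [LinearEquiv.symm_apply_eq, hψ, ← LieEquiv.map_lie]
  simp

/-- Reading `T (a, b)` as `a + t b`, the three bracket conditions say that `g` is `L ⊗ k[t]/(t² - αt
- β)`. Each concrete model of the envelope only has to supply such a `T`. -/
theorem nonempty_envelope_lieEquiv [LieAlgebra.IsSimple k L] (hβ : β ≠ 0)
    (hmul : ∀ x y, f (A.mul x y) = α • ⁅f x, f y⁆)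
    (htriple : ∀ x y z, f (A.triple x y z) = β • ⁅⁅f x, f y⁆, f z⁆)
    {g : Type*} [LieRing g] [LieAlgebra k g] (T : (L × L) ≃ₗ[k] g)
    (h₀₀ : ∀ a b : L, ⁅T (a, 0), T (b, 0)⁆ = T (⁅a, b⁆, 0))
    (h₀₁ : ∀ a b : L, ⁅T (a, 0), T (0, b)⁆ = T (0, ⁅a, b⁆))
    (h₁₁ : ∀ a b : L, ⁅T (0, a), T (0, b)⁆ = T (β • ⁅a, b⁆, α • ⁅a, b⁆)) :
    Nonempty (A.Envelope ≃ₗ⁅k⁆ g) := by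
  obtain ⟨ψ, hψ⟩ := exists_lieEquiv_innerDer hβ htriple
  have hD : ∀ x y, ψ.symm (A.D x y) = β • ⁅f x, f y⁆ := by
    intro x y
    rw [LieEquiv.symm_apply_eq]
    apply Subtype.ext
    ext z
    apply f.injective
    rw [A.D_apply, htriple, hψ, smul_lie]
  have hT : ∀ a b, T (a, b) = T (a, 0) + T (0, b) := fun a b => by rw [← map_add]; simp
  let e : A.Envelope ≃ₗ[k] (L × L) :=
    { toFun := fun p => (ψ.symm p.der, f p.vec)
      invFun := fun q => ⟨ψ q.1, f.symm q.2⟩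
      map_add' := fun p q => Prod.ext (map_add ψ.symm p.der q.der) (map_add f p.vec q.vec)
      map_smul' := fun c p => Prod.ext (map_smul ψ.symm c p.der) (map_smul f c p.vec)
      left_inv := fun p => Envelope.ext (ψ.apply_symm_apply _) (f.symm_apply_apply _)
      right_inv := fun q => Prod.ext (ψ.symm_apply_apply _) (f.apply_symm_apply _) }
  refine ⟨{ e.trans T with map_lie' := ?_ }⟩
  intro p q
  obtain ⟨d, x⟩ := p
  obtain ⟨d', y⟩ := q
  obtain ⟨a, rfl⟩ := ψ.surjective d
  obtain ⟨b, rfl⟩ := ψ.surjective d'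
  change T (ψ.symm (⁅ψ a, ψ b⁆ + A.D x y),
      f ((ψ a : Module.End k m) y - (ψ b : Module.End k m) x + A.mul x y)) =
    ⁅T (ψ.symm (ψ a), f x), T (ψ.symm (ψ b), f y)⁆
  rw [map_add, hD, ← LieEquiv.map_lie, ψ.symm_apply_apply, ψ.symm_apply_apply,
    ψ.symm_apply_apply, map_add, map_sub, hψ, hψ, hmul, hT a, hT b, add_lie, lie_add, lie_add,
    h₀₀, h₀₁, h₁₁, ← lie_skew (T (0, f x)), h₀₁, ← map_neg, ← map_add, ← map_add, ← map_add]
  congr 1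
  ext
  · simp
  · simp only [Prod.snd_add, Prod.snd_neg]
    abel

theorem nonempty_envelope_lieEquiv_prod [LieAlgebra.IsSimple k L] (hβ : β ≠ 0)
    (hmul : ∀ x y, f (A.mul x y) = α • ⁅f x, f y⁆)
    (htriple : ∀ x y z, f (A.triple x y z) = β • ⁅⁅f x, f y⁆, f z⁆)
    {r s : k} (hrs : r ≠ s) (hr : r * r = β + α * r) (hs : s * s = β + α * s) :
    Nonempty (A.Envelope ≃ₗ⁅k⁆ (L × L)) := by
  have hd : r - s ≠ 0 := sub_ne_zero.mpr hrs
  -- Evaluation of `a + t b` at the two roots `t = r` and `t = s`.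
  let T : (L × L) ≃ₗ[k] (L × L) :=
    { toFun := fun p => (p.1 + r • p.2, p.1 + s • p.2)
      invFun := fun q =>
        (q.1 - r • ((r - s)⁻¹ • (q.1 - q.2)), (r - s)⁻¹ • (q.1 - q.2))
      map_add' := fun p q => by ext <;> simp only [Prod.fst_add, Prod.snd_add] <;> module
      map_smul' := fun c p => by
        ext <;> simp only [Prod.smul_fst, Prod.smul_snd, RingHom.id_apply] <;> module
      left_inv := fun p => by
        have h : (r - s)⁻¹ • (p.1 + r • p.2 - (p.1 + s • p.2)) = p.2 := by
          rw [add_sub_add_left_eq_sub, ← sub_smul, inv_smul_smul₀ hd]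
        simp only [h]
        ext <;> simp
      right_inv := fun q => by
        ext
        · simp
        · have h : q.1 - r • ((r - s)⁻¹ • (q.1 - q.2)) + s • ((r - s)⁻¹ • (q.1 - q.2)) =
              q.1 - (r - s) • ((r - s)⁻¹ • (q.1 - q.2)) := by module
          simp only [h, smul_inv_smul₀ hd]
          abel }
  have hT : ∀ a b, T (a, b) = (a + r • b, a + s • b) := fun a b => rfl
  refine nonempty_envelope_lieEquiv hβ hmul htriple T ?_ ?_ ?_ <;> intro a b <;>
    simp only [hT, LieAlgebra.Prod.bracket_apply, smul_zero, add_zero, zero_add, lie_smul,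
      smul_lie, smul_smul]
  rw [hr, hs, mul_comm α, mul_comm α, ← add_smul, ← add_smul]

theorem lie_one_tmul_add_tmul (k : Type*) {R L : Type*} [Field k] [LieRing L] [LieAlgebra k L]
    [CommRing R] [Algebra k R] (t : R) (ht : t * t = 0) (a a' b b' : L) :
    ⁅(1 : R) ⊗ₜ[k] a + t ⊗ₜ[k] a', (1 : R) ⊗ₜ[k] b + t ⊗ₜ[k] b'⁆ =
      (1 : R) ⊗ₜ[k] ⁅a, b⁆ + t ⊗ₜ[k] (⁅a, b'⁆ + ⁅a', b⁆) := by
  simp only [add_lie, lie_add, LieAlgebra.ExtendScalars.bracket_tmul, ht,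
    TensorProduct.zero_tmul, one_mul, mul_one, add_zero, TensorProduct.tmul_add]
  abel

/-- `L × L` is the space of `1 ⊗ a + t ⊗ b` in `k[t]/(t²) ⊗ L`. -/
theorem exists_linearEquiv_tensor (k L : Type*) [Field k] [LieRing L] [LieAlgebra k L] :
    ∃ S : (L × L) ≃ₗ[k] ((k[X] ⧸ Ideal.span {(Polynomial.X : k[X]) ^ 2}) ⊗[k] L),
      ∀ a b, S (a, b) =
        1 ⊗ₜ a + (Ideal.Quotient.mk (Ideal.span {(Polynomial.X : k[X]) ^ 2}) Polynomial.X) ⊗ₜ b := by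
  let P := AdjoinRoot.powerBasis' (Polynomial.monic_X_pow (R := k) 2)
  have hdim : P.dim = 2 := by simp [P]
  let B : Module.Basis (Fin 2) k (k[X] ⧸ Ideal.span {(Polynomial.X : k[X]) ^ 2}) :=
    P.basis.reindex (finCongr hdim)
  have hB : ∀ i, B i =
      (Ideal.Quotient.mk (Ideal.span {(Polynomial.X : k[X]) ^ 2}) Polynomial.X) ^ (i : ℕ) := by
    intro i
    change P.basis.reindex (finCongr hdim) i = _
    rw [Module.Basis.reindex_apply, P.basis_eq_pow]
    rfl
  let S := (LinearEquiv.finTwoArrow k L).symm.trans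
    ((Finsupp.linearEquivFunOnFinite k L (Fin 2)).symm.trans
      (TensorProduct.equivFinsuppOfBasisLeft B).symm)
  refine ⟨S, fun a b => ?_⟩
  change (TensorProduct.equivFinsuppOfBasisLeft B).symm _ = _
  rw [TensorProduct.equivFinsuppOfBasisLeft_symm_apply, Finsupp.sum_fintype _ _ (by simp),
    Fin.sum_univ_two, hB, hB]
  simp

theorem nonempty_envelope_lieEquiv_tensor [CharZero k] [LieAlgebra.IsSimple k L]
    (hmul : ∀ x y, f (A.mul x y) = ⁅f x, f y⁆)
    (htriple : ∀ x y z, f (A.triple x y z) = (-1 / 4 : k) • ⁅⁅f x, f y⁆, f z⁆) :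
    Nonempty (A.Envelope ≃ₗ⁅k⁆
      ((k[X] ⧸ Ideal.span {(Polynomial.X : k[X]) ^ 2}) ⊗[k] L)) := by
  obtain ⟨S, hS⟩ := exists_linearEquiv_tensor k L
  have ht : (Ideal.Quotient.mk (Ideal.span {(Polynomial.X : k[X]) ^ 2}) Polynomial.X) *
      (Ideal.Quotient.mk (Ideal.span {(Polynomial.X : k[X]) ^ 2}) Polynomial.X) = 0 := by
    rw [← map_mul, ← sq, Ideal.Quotient.eq_zero_iff_mem]
    exact Ideal.mem_span_singleton_self _
  -- With `β = -1/4` the relation reads `(t - 1/2)² = 0`; this substitutes `t = 1/2 + ε` with `ε² =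
  -- 0`.
  let T₀ : (L × L) ≃ₗ[k] (L × L) :=
    { toFun := fun p => (p.1 + (1 / 2 : k) • p.2, p.2)
      invFun := fun p => (p.1 - (1 / 2 : k) • p.2, p.2)
      map_add' := fun p q => by ext <;> simp only [Prod.fst_add, Prod.snd_add]; module
      map_smul' := fun c p => by
        ext <;> simp only [Prod.smul_fst, Prod.smul_snd, RingHom.id_apply]; module
      left_inv := fun p => by ext <;> simp
      right_inv := fun p => by ext <;> simp }
  have hT : ∀ a b, (T₀.trans S) (a, b) = S (a + (1 / 2 : k) • b, b) := fun a b => rfl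
  have hbr : ∀ a a' b b', ⁅S (a, a'), S (b, b')⁆ = S (⁅a, b⁆, ⁅a, b'⁆ + ⁅a', b⁆) := by
    intro a a' b b'
    rw [hS, hS, hS]
    refine (lie_one_tmul_add_tmul k _ ht a a' b b').trans ?_
    rfl
  refine nonempty_envelope_lieEquiv (α := 1) (by norm_num) (by simpa using hmul) htriple
    (T₀.trans S) ?_ ?_ ?_ <;> intro a b <;> rw [hT, hT, hT, hbr] <;> congr 1 <;> ext
  · simp
  · simp
  · simp
  · simp
  · simp only [smul_lie, lie_smul, zero_add]
    module
  · simp only [smul_lie, lie_smul, zero_add]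
    module

end OfLieType

end LYAlgebra

/-! ### From adjoint type to a simple Lie algebra. -/

namespace LYAlgebra

variable {k m : Type*} [Field k] [AddCommGroup m] [Module k m] {A : LYAlgebra k m}

/-- The ideals of `D(m,m)` correspond to the submodules of `m`. An abelian `D(m,m)` would act as
zero on `m`; consisting of endomorphisms of `m`, it would be zero, and so would `m`. -/
theorem isSimple_innerDer (hirr : A.IsIrreducible)
    (φ : A.innerDer ≃ₗ⁅k, A.innerDer⁆ m) : LieAlgebra.IsSimple k A.innerDer := by
  have hφ : ∀ d e : A.innerDer, φ ⁅d, e⁆ = (d : Module.End k m) (φ e) := fun d e =>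
    φ.toLieModuleHom.map_lie d e
  have : IsSimpleOrder (LieSubmodule k A.innerDer m) := hirr
  refine (LieAlgebra.isSimple_iff_of_not_isLieAbelian k A.innerDer ?_).mp
    (LieSubmodule.orderIsoMapComap φ).isSimpleOrder
  intro hab
  have hzero : ∀ d : A.innerDer, d = 0 := by
    intro d
    apply Subtype.ext
    ext z
    obtain ⟨e, rfl⟩ := φ.surjective z
    have h0 : ⁅d, e⁆ = 0 := hab.trivial d e
    rw [← hφ, h0]
    exact φ.map_zero
  have hm : ∀ z : m, z = 0 := by
    intro z
    obtain ⟨e, rfl⟩ := φ.surjective z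
    rw [hzero e]
    exact φ.map_zero
  refine bot_ne_top (α := LieSubmodule k A.innerDer m) ?_
  ext z
  rw [hm z]
  simp

theorem exists_mul_triple_eq_smul [IsAlgClosed k] [CharZero k] [FiniteDimensional k m]
    [LieAlgebra.IsSimple k A.innerDer] (φ : A.innerDer ≃ₗ⁅k, A.innerDer⁆ m) :
    ∃ (f : m ≃ₗ[k] A.innerDer) (α β : k), β ≠ 0 ∧
      (∀ x y, f (A.mul x y) = α • ⁅f x, f y⁆) ∧
      (∀ x y z, f (A.triple x y z) = β • ⁅⁅f x, f y⁆, f z⁆) := by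
  let f : m ≃ₗ[k] A.innerDer :=
    { φ.symm.toLieModuleHom.toLinearMap with
      invFun := φ
      left_inv := φ.apply_symm_apply
      right_inv := φ.symm_apply_apply }
  have hf : ∀ (d : A.innerDer) (z : m), f ((d : Module.End k m) z) = ⁅d, f z⁆ := fun d z =>
    φ.symm.toLieModuleHom.map_lie d z
  have hf' : ∀ d e : A.innerDer, f.symm ⁅d, e⁆ = (d : Module.End k m) (f.symm e) := fun d e =>
    φ.toLieModuleHom.map_lie d e
  -- `μ` and `τ` are `x · y` and `D(x,y)` carried to `D(m,m)`; they are equivariant because inner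
  -- derivations respect both products.
  let μ : A.innerDer →ₗ[k] A.innerDer →ₗ[k] A.innerDer :=
    LinearMap.mk₂ k (fun d e => f (A.mul (f.symm d) (f.symm e)))
      (fun _ _ _ => by simp) (fun _ _ _ => by simp) (fun _ _ _ => by simp)
      (fun _ _ _ => by simp)
  let τ : A.innerDer →ₗ[k] A.innerDer →ₗ[k] A.innerDer :=
    LinearMap.mk₂ k (fun d e => A.D (f.symm d) (f.symm e))
      (fun _ _ _ => Subtype.ext (by simp [D])) (fun _ _ _ => Subtype.ext (by simp [D]))
      (fun _ _ _ => Subtype.ext (by simp [D])) (fun _ _ _ => Subtype.ext (by simp [D]))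
  obtain ⟨α, hα⟩ := LieAlgebra.IsSimple.exists_eq_smul_lie (f := μ)
    (fun d => by
      change f (A.mul (f.symm d) (f.symm d)) = 0
      rw [A.mul_self, map_zero])
    (fun c d e => by
      change ⁅c, f (A.mul (f.symm d) (f.symm e))⁆ =
        f (A.mul (f.symm ⁅c, d⁆) (f.symm e)) + f (A.mul (f.symm d) (f.symm ⁅c, e⁆))
      rw [← hf, A.innerDer_mul, hf', hf', map_add])
  obtain ⟨β, hβ⟩ := LieAlgebra.IsSimple.exists_eq_smul_lie (f := τ)
    (fun d => by
      change A.D (f.symm d) (f.symm d) = 0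
      exact Subtype.ext (LinearMap.ext fun z => A.triple_self _ z))
    (fun c d e => by
      change ⁅c, A.D (f.symm d) (f.symm e)⁆ =
        A.D (f.symm ⁅c, d⁆) (f.symm e) + A.D (f.symm d) (f.symm ⁅c, e⁆)
      rw [hf', hf']
      apply Subtype.ext
      ext z
      change (c : Module.End k m) (A.triple (f.symm d) (f.symm e) z) -
        A.triple (f.symm d) (f.symm e) ((c : Module.End k m) z) =
        A.triple ((c : Module.End k m) (f.symm d)) (f.symm e) z +
          A.triple (f.symm d) ((c : Module.End k m) (f.symm e)) z
      rw [A.innerDer_triple]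
      abel)
  have hμ : ∀ x y, f (A.mul x y) = α • ⁅f x, f y⁆ := fun x y => by
    rw [← hα]
    change _ = f (A.mul (f.symm (f x)) (f.symm (f y)))
    simp
  have hD : ∀ x y, A.D x y = β • ⁅f x, f y⁆ := fun x y => by
    rw [← hβ]
    change _ = A.D (f.symm (f x)) (f.symm (f y))
    simp
  refine ⟨f, α, β, ?_, hμ, fun x y z => ?_⟩
  · rintro rfl
    have := LieAlgebra.IsSimple.nontrivial k A.innerDer
    obtain ⟨d, hd⟩ := exists_ne (0 : A.innerDer)
    refine hd (Subtype.ext ?_)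
    have hd' : (d : Module.End k m) ∈
        Submodule.span k {d : Module.End k m | ∃ x y : m, d = A.triple x y} := d.2
    have hle : Submodule.span k {d : Module.End k m | ∃ x y : m, d = A.triple x y} ≤ ⊥ := by
      refine Submodule.span_le.mpr ?_
      rintro - ⟨x, y, rfl⟩
      have := hD x y
      rw [zero_smul] at this
      exact congrArg Subtype.val this
    exact (Submodule.mem_bot k).mp (hle hd')
  · rw [← A.D_apply, hf, hD, smul_lie]

/-- Scale `f` by a square root of `β` if `α = 0`, and by `α` otherwise. -/
theorem isomorphic_ofLie_of_mul_triple {L : Type*} [LieRing L] [LieAlgebra k L]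
    [IsAlgClosed k] (f : m ≃ₗ[k] L) {α β : k} (hβ : β ≠ 0)
    (hmul : ∀ x y, f (A.mul x y) = α • ⁅f x, f y⁆)
    (htriple : ∀ x y z, f (A.triple x y z) = β • ⁅⁅f x, f y⁆, f z⁆) :
    A.Isomorphic (ofLie k L 0 1) ∨ ∃ γ : k, γ ≠ 0 ∧ A.Isomorphic (ofLie k L 1 γ) := by
  rcases eq_or_ne α 0 with rfl | hα
  · left
    obtain ⟨c, hc⟩ := IsAlgClosed.exists_pow_nat_eq β two_pos
    have hc0 : c ≠ 0 := by rintro rfl; exact hβ (by rw [← hc]; simp)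
    refine ⟨f.trans (LinearEquiv.smulOfNeZero k L c hc0), fun x y => ?_, fun x y z => ?_⟩
    · simp [hmul, ofLie_mul]
    · simp only [LinearEquiv.trans_apply, LinearEquiv.smulOfNeZero_apply, htriple, ofLie_triple,
        smul_lie, lie_smul, smul_smul, ← hc]
      congr 1
      ring
  · right
    refine ⟨β / α ^ 2, div_ne_zero hβ (pow_ne_zero 2 hα),
      f.trans (LinearEquiv.smulOfNeZero k L α hα), fun x y => ?_, fun x y z => ?_⟩
    · simp [hmul, ofLie_mul, smul_smul]
    · simp only [LinearEquiv.trans_apply, LinearEquiv.smulOfNeZero_apply, htriple, ofLie_triple,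
        smul_lie, lie_smul, smul_smul]
      congr 1
      field_simp

end LYAlgebra

/-! ### The classification and the envelopes. -/

theorem mainTheorem3 {k : Type u} [Field k] [IsAlgClosed k] [CharZero k] :
    -- the irreducible LY-algebras of adjoint type are, up to isomorphism, those of the list
    (∀ (m : Type v) [AddCommGroup m] [Module k m] [FiniteDimensional k m] (A : LYAlgebra k m),
      (A.IsIrreducible ∧ A.IsAdjointType) ↔
        ∃ (L : Type v) (_ : LieRing L) (_ : LieAlgebra k L),
          FiniteDimensional k L ∧ LieAlgebra.IsSimple k L ∧
            (A.Isomorphic (LYAlgebra.ofLie k L 0 1) ∨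
              ∃ β : k, β ≠ 0 ∧ A.Isomorphic (LYAlgebra.ofLie k L 1 β))) ∧
    -- their standard enveloping Lie algebras
    (∀ (L : Type w) [LieRing L] [LieAlgebra k L] [FiniteDimensional k L] [LieAlgebra.IsSimple k L]
      (m : Type v) [AddCommGroup m] [Module k m] (A : LYAlgebra k m),
      (A.Isomorphic (LYAlgebra.ofLie k L 0 1) → Nonempty (A.Envelope ≃ₗ⁅k⁆ (L × L))) ∧
      (∀ β : k, β ≠ 0 → A.Isomorphic (LYAlgebra.ofLie k L 1 β) →
        (β ≠ -1 / 4 → Nonempty (A.Envelope ≃ₗ⁅k⁆ (L × L))) ∧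
        (β = -1 / 4 →
          Nonempty (A.Envelope ≃ₗ⁅k⁆
            ((k[X] ⧸ Ideal.span {(Polynomial.X : k[X]) ^ 2}) ⊗[k] L))))) := by
  refine ⟨fun m _ _ _ A => ⟨?_, ?_⟩, fun L _ _ _ _ m _ _ A => ⟨?_, fun β hβ => ?_⟩⟩
  · rintro ⟨hirr, ⟨φ⟩⟩
    have := LYAlgebra.isSimple_innerDer hirr φ
    obtain ⟨f, α, β, hβ, hmul, htriple⟩ := LYAlgebra.exists_mul_triple_eq_smul φ
    exact ⟨A.innerDer, inferInstance, inferInstance, inferInstance, this,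
      LYAlgebra.isomorphic_ofLie_of_mul_triple f hβ hmul htriple⟩
  · rintro ⟨L, _, _, -, _, ⟨f, -, htriple⟩ | ⟨β, hβ, f, -, htriple⟩⟩
    · simp only [LYAlgebra.ofLie_triple] at htriple
      exact ⟨LYAlgebra.isIrreducible_of_triple_eq one_ne_zero htriple,
        LYAlgebra.isAdjointType_of_triple_eq one_ne_zero htriple⟩
    · simp only [LYAlgebra.ofLie_triple] at htriple
      exact ⟨LYAlgebra.isIrreducible_of_triple_eq hβ htriple,
        LYAlgebra.isAdjointType_of_triple_eq hβ htriple⟩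
  · rintro ⟨f, hmul, htriple⟩
    simp only [LYAlgebra.ofLie_mul, LYAlgebra.ofLie_triple] at hmul htriple
    -- The roots of `t² = 1`, as `α = 0` and `β = 1`.
    refine LYAlgebra.nonempty_envelope_lieEquiv_prod one_ne_zero hmul htriple (r := 1) (s := -1)
      ?_ (by ring) (by ring)
    intro h
    have : (2 : k) = 0 := by linear_combination h
    exact two_ne_zero this
  · rintro ⟨f, hmul, htriple⟩
    simp only [LYAlgebra.ofLie_mul, LYAlgebra.ofLie_triple] at hmul htriple
    constructor
    · intro hβ4
      -- `1 + 4β` is the discriminant of `t² - t - β`, so the roots are `(1 ± d)/2`.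
      obtain ⟨d, hd⟩ := IsAlgClosed.exists_pow_nat_eq (1 + 4 * β) two_pos
      have hd0 : d ≠ 0 := by
        rintro rfl
        apply hβ4
        linear_combination (-1 / 4 : k) * hd
      refine LYAlgebra.nonempty_envelope_lieEquiv_prod hβ hmul htriple
        (r := (1 + d) / 2) (s := (1 - d) / 2) ?_ ?_ ?_
      · intro h
        apply hd0
        linear_combination h
      · linear_combination (1 / 4 : k) * hd
      · linear_combination (1 / 4 : k) * hd
    · rintro rfl
      exact LYAlgebra.nonempty_envelope_lieEquiv_tensor (by simpa using hmul) htriple
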